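/- For a subgroup $H$ of a group $G$, say that $H$ is a \emph{virtual retract} of $G$ if there is a finite index subgroup $K\leqslant G$ with $H\subseteq K$ and a homomorphism $K\to H$ restricting to the identity on $H$. A group has \emph{property (LR)} if all its finitely generated subgroups are virtual retracts. Two groups are \emph{commensurable} if they have isomorphic subgroups of finite index. Let $A=\mathbb{Z}_2\times\mathbb{Z}_2$, let $G=A\wr\mathbb{Z}$ be the restricted wreath product, and let $\alpha$ be the automorphism of $G$ which applies the automorphism $(x,y)\mapsto(x+y,y)$ of $A$ to the values of the finitely supported functions $\mathbb{Z}\to A$ and fixes the acting group $\mathbb{Z}$. Let $\tilde G=G\rtimes\langle\alpha\rangle$. Then: (1) $G$ has property (LR); (2) $\alpha\in\tilde G$ has order $2$, and $G$ has index $2$ in $\tilde G$; (3) the centralizer $\mathrm{C}_{\tilde G}(\alpha)$ is finitely generated but is not a virtual retract of $\tilde G$; thus $\tilde G$ does not have property (LR). Consequently, property (LR) is not invariant under commensurability of groups. -/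

import Mathlib

/-- `H` is a virtual retract of `G`: there is a finite index subgroup `K` of `G` containing `H`
and a homomorphism `K →* H` which restricts to the identity on `H`. -/
def IsVirtualRetract {G : Type*} [Group G] (H : Subgroup G) : Prop :=
  ∃ K : Subgroup G, K.FiniteIndex ∧ ∃ hHK : H ≤ K,
    ∃ ρ : K →* H, ∀ h : H, ρ (Subgroup.inclusion hHK h) = h

/-- Property (LR): every finitely generated subgroup is a virtual retract. -/
def HasLR (G : Type*) [Group G] : Prop :=
  ∀ H : Subgroup G, H.FG → IsVirtualRetract H

/-- Two groups are (abstractly) commensurable if they have isomorphic finite index subgroups. -/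
def AreCommensurable (G₁ G₂ : Type*) [Group G₁] [Group G₂] : Prop :=
  ∃ (H₁ : Subgroup G₁) (H₂ : Subgroup G₂),
    H₁.FiniteIndex ∧ H₂.FiniteIndex ∧ Nonempty (H₁ ≃* H₂)

/-- The restricted wreath product `A ≀ B`: the subgroup of Mathlib's unrestricted regular wreath
product `(B → A) ⋊ B` of those pairs whose function `B → A` has finite support. -/
def restrictedWreath (A B : Type*) [Group A] [Group B] : Subgroup (RegularWreathProduct A B) where
  carrier := {g | g.left.mulSupport.Finite}
  one_mem' := by simp
  mul_mem' := by
    intro a b ha hb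
    have hb' : (Function.mulSupport fun x ↦ b.left (a.right⁻¹ * x)).Finite :=
      Set.Finite.preimage (mul_right_injective a.right⁻¹).injOn hb
    exact (ha.union hb').subset (Function.mulSupport_mul _ _)
  inv_mem' := by
    intro a ha
    have h : (Function.mulSupport fun x ↦ a.left⁻¹ (a.right * x)).Finite := by
      refine Set.Finite.preimage (mul_right_injective a.right).injOn (s := a.left⁻¹.mulSupport) ?_
      rw [Function.mulSupport_inv]
      exact ha
    exact h

/-- The endomorphism of `A ≀ B` induced by an endomorphism `θ` of `A`: it applies `θ` to the values
of the functions `B → A` and fixes `B`. -/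
def restrictedWreathMap {A B : Type*} [Group A] [Group B] (θ : A →* A) :
    restrictedWreath A B →* restrictedWreath A B where
  toFun g := ⟨⟨fun x ↦ θ (g.1.left x), g.1.right⟩,
    Set.Finite.subset g.2 (fun x hx h ↦ hx (by simp [h]))⟩
  map_one' := by ext <;> simp
  map_mul' a b := by ext <;> simp

/-- The automorphism of `A ≀ B` induced by an automorphism `θ` of `A`: it applies `θ` to the values
of the functions `B → A` and fixes `B`. -/
def restrictedWreathAut {A B : Type*} [Group A] [Group B] (θ : MulAut A) :
    MulAut (restrictedWreath A B) :=
  MonoidHom.toMulEquiv (restrictedWreathMap θ.toMonoidHom) (restrictedWreathMap θ.symm.toMonoidHom)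
    (by ext <;> simp [restrictedWreathMap]) (by ext <;> simp [restrictedWreathMap])

/-- The Klein four-group `ℤ₂ × ℤ₂`, written multiplicatively. -/
abbrev KleinFour : Type := Multiplicative (ZMod 2 × ZMod 2)

/-- The group `(ℤ₂)² ≀ ℤ`. -/
abbrev KleinWreathZ : Type := restrictedWreath KleinFour (Multiplicative ℤ)

/-- The automorphism `(x, y) ↦ (x + y, y)` of `ℤ₂ × ℤ₂`; it fixes `(1, 0)` and sends `(0, 1)` to
`(1, 1)`. -/
def kleinShear : MulAut KleinFour :=
  AddEquiv.toMultiplicative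
    { toFun := fun v ↦ (v.1 + v.2, v.2)
      invFun := fun v ↦ (v.1 + v.2, v.2)
      left_inv := by decide
      right_inv := by decide
      map_add' := by decide }

/-- The automorphism `α` of `(ℤ₂)² ≀ ℤ` induced by `kleinShear`. -/
def alphaAut : MulAut KleinWreathZ := restrictedWreathAut kleinShear

/-- The overgroup `((ℤ₂)² ≀ ℤ) ⋊ ⟨α⟩`, where `⟨α⟩` is the subgroup of the automorphism group
generated by `α`, with its natural action. -/
abbrev KleinWreathOvergroup : Type :=
  KleinWreathZ ⋊[(Subgroup.zpowers alphaAut).subtype] Subgroup.zpowers alphaAut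

/-- The element `α` of the overgroup. -/
def alphaElt : KleinWreathOvergroup :=
  SemidirectProduct.inr ⟨alphaAut, Subgroup.mem_zpowers alphaAut⟩

/-! Why `G` has (LR): it suffices to find `L`, normalized by `H` and meeting it trivially, with `LH`
of finite index (`isVirtualRetract_of_complement`). If `H` lies in the base group, its elements have
supports in one finite set `U`. Reducing `ℤ` modulo a large `n` is injective on `U`, so the kernel
of the reduction serves as `L`. Otherwise `H` projects onto `mℤ` with `m ≠ 0`, and its intersection
`N` with the base is a submodule over `𝔽_p[T;T⁻¹]`, where `T` translates by `m`. The base is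
finitely generated over this ring, and proper quotients of the ring are finite. A maximal submodule
`N'` independent of `N` thus makes `N + N'` of finite index, and `L = N'` works.

Why the overgroup fails: suppose `ρ : K → C(α)` is a retraction and `x ∈ K` lies in the base. The
commutator `[α, x]` is fixed by `α`, so `ρ` fixes it; but `ρ [α, x] = [α, ρ x] = 1`. Hence `α` fixes
all of `K ∩ base`, which is impossible when `K` has finite index. -/

open scoped LaurentPolynomial Pointwise

/-! ### Criteria for virtual retracts and finite index -/

/-- A subgroup is a virtual retract as soon as it normalizes a subgroup `L` with which it
intersects trivially and spans a subgroup of finite index. -/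
theorem isVirtualRetract_of_complement {G : Type*} [Group G] {H L : Subgroup G}
    (hn : H ≤ Subgroup.normalizer L) (hd : Disjoint L H) (hf : (L ⊔ H).FiniteIndex) :
    IsVirtualRetract H := by
  have hle : H ≤ L ⊔ H := le_sup_right
  have hnorm : (L.subgroupOf (L ⊔ H)).Normal :=
    Subgroup.normal_subgroupOf_of_le_normalizer (sup_le Subgroup.le_normalizer hn)
  -- `H` maps isomorphically onto `LH/L`; the retraction is the quotient map followed by the
  -- inverse.
  let q : H →* (L ⊔ H : Subgroup G) ⧸ L.subgroupOf (L ⊔ H) :=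
    (QuotientGroup.mk' _).comp (Subgroup.inclusion hle)
  have hq : Function.Bijective q := by
    constructor
    · rw [injective_iff_map_eq_one]
      intro h hh
      have hL : (h : G) ∈ L := by
        simpa [q, QuotientGroup.eq_one_iff, Subgroup.mem_subgroupOf] using hh
      exact Subtype.ext (Subgroup.disjoint_def.1 hd hL h.2)
    · intro x
      obtain ⟨⟨g, hg⟩, rfl⟩ := QuotientGroup.mk_surjective x
      have hg' : g ∈ (H : Set G) * (L : Set G) := by
        rw [← Subgroup.coe_mul_of_left_le_normalizer_right _ _ hn, sup_comm]
        exact hg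
      obtain ⟨h, hh, l, hl, rfl⟩ := Set.mem_mul.1 hg'
      refine ⟨⟨h, hh⟩, ?_⟩
      refine QuotientGroup.eq.2 ?_
      simpa [Subgroup.mem_subgroupOf] using hl
  let e := MulEquiv.ofBijective q hq
  exact ⟨L ⊔ H, hf, hle, e.symm.toMonoidHom.comp (QuotientGroup.mk' _),
    fun h ↦ e.symm_apply_apply h⟩

/-- A subgroup is of finite index if a map to a finite type separates its left cosets. -/
theorem Subgroup.finiteIndex_of_separating {G α : Type*} [Group G] [Finite α] (L : Subgroup G)
    (f : G → α) (hf : ∀ g h, f g = f h → g⁻¹ * h ∈ L) : L.FiniteIndex := by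
  have : Finite (G ⧸ L) := Finite.of_injective (fun x : G ⧸ L ↦ f x.out) fun x y hxy ↦ by
    rw [← x.out_eq', ← y.out_eq']
    exact QuotientGroup.eq.2 (hf _ _ hxy)
  exact Subgroup.finiteIndex_of_finite_quotient

/-- A subgroup `K` is of finite index if `K ⊓ B` is of finite index in a normal subgroup `B` and
`K ⊔ B` is of finite index. -/
theorem Subgroup.finiteIndex_of_finiteIndex_sup {G : Type*} [Group G] (K B : Subgroup G)
    [B.Normal] (hB : (K.subgroupOf B).FiniteIndex) (hsup : (K ⊔ B).FiniteIndex) :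
    K.FiniteIndex := by
  have hdec : ∀ g : (K ⊔ B : Subgroup G), ∃ b : B, (b : G)⁻¹ * g ∈ K := by
    rintro ⟨g, hg⟩
    rw [sup_comm, ← SetLike.mem_coe, Subgroup.normal_mul] at hg
    obtain ⟨b, hb, k, hk, rfl⟩ := Set.mem_mul.1 hg
    exact ⟨⟨b, hb⟩, by simpa using hk⟩
  choose b hb using hdec
  have hrel : (K.subgroupOf (K ⊔ B)).FiniteIndex := by
    -- Writing `g = b k` and `h = b' k'`, one has `g⁻¹h = k⁻¹(b⁻¹b')k'`, so the class of `b` modulo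
    -- `K ∩ B` separates cosets.
    refine Subgroup.finiteIndex_of_separating _
      (fun g ↦ (b g : B ⧸ K.subgroupOf B)) fun g h hgh ↦ ?_
    have hbb : (b g : G)⁻¹ * b h ∈ K := by
      simpa [Subgroup.mem_subgroupOf] using QuotientGroup.eq.1 hgh
    have := K.mul_mem (K.mul_mem (K.inv_mem (hb g)) hbb) (hb h)
    rw [Subgroup.mem_subgroupOf]
    simpa [mul_assoc] using this
  constructor
  rw [← Subgroup.relIndex_mul_index (le_sup_left : K ≤ K ⊔ B)]
  exact mul_ne_zero hrel.index_ne_zero hsup.index_ne_zero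

/-! ### Modules over Laurent polynomials -/

/-- Laurent polynomials over a finite field have finite proper quotients. -/
instance LaurentPolynomial.hasFiniteQuotients (k : Type*) [Field k] [Finite k] :
    Ring.HasFiniteQuotients k[T;T⁻¹] where
  finiteQuotient {I} hI := by
    obtain ⟨r, hr, hr0⟩ := Submodule.exists_mem_ne_zero_of_ne_bot hI
    -- A power of `T` turns `r` into a polynomial vanishing at `f T`. Using this also after `T ↦
    -- T⁻¹` makes both `T` and `T⁻¹` integral, so the quotient is finite-dimensional.
    have key : ∀ (f : k[T;T⁻¹] →ₐ[k] k[T;T⁻¹] ⧸ I) (r : k[T;T⁻¹]), r ≠ 0 → f r = 0 →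
        IsIntegral k (f (LaurentPolynomial.T 1)) := by
      intro f r hr0 hr
      obtain ⟨n, p, hp⟩ := r.exists_T_pow
      have hp0 : p ≠ 0 := by
        rintro rfl
        rw [map_zero] at hp
        exact hr0 ((LaurentPolynomial.isUnit_T n).mul_left_eq_zero.1 hp.symm)
      refine IsAlgebraic.isIntegral ⟨p, hp0, ?_⟩
      have hpx : Polynomial.aeval (LaurentPolynomial.T 1 : k[T;T⁻¹]) p
          = Polynomial.toLaurent p := by
        rw [← Polynomial.toLaurentAlg_apply, ← Polynomial.toLaurent_X,
          ← Polynomial.toLaurentAlg_apply, Polynomial.aeval_algHom_apply, Polynomial.aeval_X_left]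
        rfl
      rw [Polynomial.aeval_algHom_apply, hpx, hp, map_mul, hr, zero_mul]
    have hq0 : Ideal.Quotient.mkₐ k I r = 0 := Ideal.Quotient.eq_zero_iff_mem.2 hr
    have hT := key (Ideal.Quotient.mkₐ k I) r hr0 hq0
    have hT' := key ((Ideal.Quotient.mkₐ k I).comp LaurentPolynomial.invert.toAlgHom)
      (LaurentPolynomial.invert r) (by simpa using hr0)
      (by simpa [LaurentPolynomial.involutive_invert r] using hq0)
    have hint : Algebra.IsIntegral k (k[T;T⁻¹] ⧸ I) := by
      refine ⟨fun x ↦ ?_⟩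
      obtain ⟨p, rfl⟩ := Ideal.Quotient.mkₐ_surjective k I x
      induction p using LaurentPolynomial.induction_on with
      | h_C a => exact isIntegral_algebraMap
      | h_add hp hq => rw [map_add]; exact hp.add hq
      | h_C_mul_T n a h =>
        rw [LaurentPolynomial.T_add, ← mul_assoc, map_mul]
        exact h.mul hT
      | h_C_mul_T_Z n a h =>
        rw [LaurentPolynomial.T_sub, ← mul_assoc, map_mul]
        refine h.mul ?_
        simpa using hT'
    have hft : Algebra.FiniteType k k[T;T⁻¹] := inferInstance
    have : Algebra.FiniteType k (k[T;T⁻¹] ⧸ I) :=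
      hft.of_surjective (Ideal.Quotient.mkₐ k I) (Ideal.Quotient.mkₐ_surjective k I)
    have : Module.Finite k (k[T;T⁻¹] ⧸ I) := Algebra.IsIntegral.finite
    exact Module.finite_of_finite k

/-- A finitely generated torsion module over a domain with finite proper quotients is finite. -/
theorem Module.finite_of_isTorsion {R M : Type*} [CommRing R] [IsDomain R]
    [Ring.HasFiniteQuotients R] [AddCommGroup M] [Module R M] [Module.Finite R M]
    (hM : Module.IsTorsion R M) : Finite M := by
  obtain ⟨r, hr, hr0⟩ := Submodule.annihilator_top_inter_nonZeroDivisors hM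
  set I : Ideal R := (⊤ : Submodule R M).annihilator
  have hI : I ≠ ⊥ := fun h ↦ nonZeroDivisors.ne_zero hr0 (by simpa [h] using hr)
  let := (Module.isTorsionBySet_annihilator_top R M).module
  have : Finite (R ⧸ I) := Ring.HasFiniteQuotients.finiteQuotient hI
  have : IsScalarTower R (R ⧸ I) M := (Module.isTorsionBySet_annihilator_top R M).isScalarTower
  have : Module.Finite (R ⧸ I) M := Module.Finite.of_restrictScalars_finite R _ _
  exact Module.finite_of_finite (R ⧸ I)

/-- Over a domain, every submodule has an independent submodule such that the quotient by their
sum is torsion. -/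
theorem Submodule.exists_disjoint_isTorsion_quotient {R M : Type*} [CommRing R] [IsDomain R]
    [AddCommGroup M] [Module R M] (N : Submodule R M) :
    ∃ N' : Submodule R M, Disjoint N N' ∧ Module.IsTorsion R (M ⧸ (N ⊔ N')) := by
  obtain ⟨N', -, hN'⟩ := zorn_le_nonempty₀ {P : Submodule R M | Disjoint N P}
    (fun c hc hchain P hP ↦ ⟨sSup c, by
      have := (hchain.directedOn).disjoint_sSup_right (a := N)
      exact this.2 fun b hb ↦ hc hb, fun z hz ↦ le_sSup hz⟩) ⊥ disjoint_bot_right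
  refine ⟨N', hN'.prop, ?_⟩
  intro x
  obtain ⟨x, rfl⟩ := Submodule.mkQ_surjective _ x
  by_cases hx : x ∈ N'
  · exact ⟨1, by simpa using Submodule.mem_sup_right hx⟩
  -- By maximality `N' + Rx` meets `N` in some `z + r x ≠ 0`; then `r ≠ 0` and `r x ∈ N + N'`.
  · have hnd : ¬ Disjoint N (N' ⊔ R ∙ x) := fun h ↦
      hx (hN'.le_of_ge h le_sup_left
        (Submodule.mem_sup_right (Submodule.mem_span_singleton_self x)))
    simp only [Submodule.disjoint_def, not_forall] at hnd
    obtain ⟨y, hyN, hy, hy0⟩ := hnd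
    obtain ⟨z, hz, w, hw, rfl⟩ := Submodule.mem_sup.1 hy
    obtain ⟨r, rfl⟩ := Submodule.mem_span_singleton.1 hw
    have hr : r ≠ 0 := by
      rintro rfl
      rw [zero_smul, add_zero] at hyN hy0
      exact hy0 (Submodule.disjoint_def.1 hN'.prop _ hyN hz)
    refine ⟨⟨r, mem_nonZeroDivisors_of_ne_zero hr⟩, ?_⟩
    rw [Submonoid.mk_smul, ← map_smul, Submodule.mkQ_apply, Submodule.Quotient.mk_eq_zero]
    have := Submodule.sub_mem _ (Submodule.mem_sup_left (T := N') hyN)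
      (Submodule.mem_sup_right (S := N) hz)
    simpa using this

/-- Let `ℤ` act linearly on a vector space over a finite field, which is finitely generated as a
module over the group algebra. Then every invariant subspace has an independent invariant subspace
such that their sum has finite index. -/
theorem exists_invariant_disjoint_finite_quotient {k V : Type*} [Field k] [Finite k]
    [AddCommGroup V] [Module k V] (e : Multiplicative ℤ →* Module.End k V) (S : Set V)
    (hfin : S.Finite)
    (hS : ∀ W : Submodule k V, (∀ n, ∀ x ∈ W, e n x ∈ W) → S ⊆ W → W = ⊤)
    (N : Submodule k V) (hN : ∀ n, ∀ x ∈ N, e n x ∈ N) :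
    ∃ N' : Submodule k V, (∀ n, ∀ x ∈ N', e n x ∈ N') ∧ Disjoint N N' ∧
      Finite (V ⧸ (N ⊔ N')) := by
  let φ : k[T;T⁻¹] →ₐ[k] Module.End k V := AddMonoidAlgebra.lift k (Module.End k V) ℤ e
  let : Module k[T;T⁻¹] V := Module.compHom V φ.toRingHom
  have hsmul : ∀ (p : k[T;T⁻¹]) (x : V), p • x = φ p x := fun _ _ ↦ rfl
  have hT : ∀ (n : ℤ) (x : V),
      (LaurentPolynomial.T n : k[T;T⁻¹]) • x = e (Multiplicative.ofAdd n) x := by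
    intro n x
    change AddMonoidAlgebra.lift k (Module.End k V) ℤ e (AddMonoidAlgebra.single n 1) x = _
    rw [AddMonoidAlgebra.lift_single, one_smul]
  have : IsScalarTower k k[T;T⁻¹] V := ⟨fun a p x ↦ by simp [hsmul]⟩
  have hmem : ∀ (W : Submodule k V), (∀ n, ∀ x ∈ W, e n x ∈ W) →
      ∀ (p : k[T;T⁻¹]) (x : V), x ∈ W → p • x ∈ W := by
    intro W hW p x hx
    induction p using LaurentPolynomial.induction_on' with
    | add p q hp hq => rw [add_smul]; exact W.add_mem hp hq
    | C_mul_T n a =>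
      rw [← LaurentPolynomial.smul_eq_C_mul, smul_assoc, hT]
      exact W.smul_mem a (hW _ x hx)
  have hinv : ∀ (W : Submodule k[T;T⁻¹] V) (n : Multiplicative ℤ), ∀ x ∈ W, e n x ∈ W := by
    intro W n x hx
    have := W.smul_mem (LaurentPolynomial.T n.toAdd) hx
    rwa [hT] at this
  have : Module.Finite k[T;T⁻¹] V := by
    refine ⟨Submodule.fg_def.2 ⟨S, hfin, ?_⟩⟩
    have := hS ((Submodule.span k[T;T⁻¹] S).restrictScalars k) (hinv _) Submodule.subset_span
    exact Submodule.restrictScalars_eq_top_iff _ _ _ |>.1 this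
  let P : Submodule k[T;T⁻¹] V := { N with smul_mem' := fun p x hx ↦ hmem N hN p x hx }
  obtain ⟨P', hd, ht⟩ := P.exists_disjoint_isTorsion_quotient
  have hPN : P.restrictScalars k = N := rfl
  refine ⟨P'.restrictScalars k, hinv P', ?_, ?_⟩
  · rw [Submodule.disjoint_def] at hd ⊢
    exact hd
  · have hfin : Finite (V ⧸ (P ⊔ P')) := Module.finite_of_isTorsion ht
    have hsup : N ⊔ P'.restrictScalars k = (P ⊔ P').restrictScalars k := by
      ext x
      simp only [Submodule.mem_sup, Submodule.restrictScalars_mem]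
      rfl
    rw [hsup]
    exact hfin

/-! ### Coordinates on the lamplighter group -/

namespace Lamplighter

/-- The lamplighter group `A ≀ ℤ` over an additively written abelian group `A`. -/
abbrev Wreath (A : Type*) [AddCommGroup A] : Type _ :=
  restrictedWreath (Multiplicative A) (Multiplicative ℤ)

variable {A : Type*} [AddCommGroup A]

/-- The projection of `A ≀ ℤ` onto `ℤ`. -/
def shift : Wreath A →* Multiplicative ℤ :=
  RegularWreathProduct.rightHom.comp (Subgroup.subtype _)

/-- The finitely supported function `ℤ → A` underlying an element of `A ≀ ℤ`. -/
noncomputable def lamps (g : Wreath A) : ℤ →₀ A :=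
  Finsupp.ofSupportFinite (fun i ↦ (g.1.left (Multiplicative.ofAdd i)).toAdd)
    (Set.Finite.preimage (Multiplicative.ofAdd.injective.injOn) g.2)

/-- The element of the base group of `A ≀ ℤ` with a given finitely supported function. -/
def base (f : ℤ →₀ A) : Wreath A :=
  ⟨⟨fun x ↦ Multiplicative.ofAdd (f x.toAdd), 1⟩,
    Set.Finite.preimage (Multiplicative.toAdd.injective.injOn) f.hasFiniteSupport⟩

/-- The inclusion of the acting group `ℤ` into `A ≀ ℤ`. -/
def translation : Multiplicative ℤ →* Wreath A :=
  RegularWreathProduct.inl.codRestrict _ fun _ ↦ by simp [restrictedWreath, Subgroup.mem_mk]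

@[simp] theorem shift_translation (x : Multiplicative ℤ) :
    shift (translation x : Wreath A) = x := rfl

theorem shift_surjective : Function.Surjective (shift (A := A)) :=
  fun x ↦ ⟨translation x, rfl⟩

theorem lamps_apply (g : Wreath A) (i : ℤ) :
    lamps g i = (g.1.left (Multiplicative.ofAdd i)).toAdd := rfl

@[simp] theorem shift_base (f : ℤ →₀ A) : shift (base f) = 1 := rfl

@[simp] theorem lamps_base (f : ℤ →₀ A) : lamps (base f) = f := by
  ext i; rfl

theorem ext_lamps {g h : Wreath A} (hs : shift g = shift h) (hl : lamps g = lamps h) : g = h := by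
  refine Subtype.ext (RegularWreathProduct.ext (funext fun x ↦ ?_) hs)
  exact DFunLike.congr_fun hl x.toAdd

theorem base_lamps {g : Wreath A} (hg : shift g = 1) : base (lamps g) = g :=
  ext_lamps (by simp [hg]) (by simp)

@[simp] theorem lamps_translation (x : Multiplicative ℤ) :
    lamps (translation x : Wreath A) = 0 := by
  ext i; rfl

@[simp] theorem lamps_one : lamps (1 : Wreath A) = 0 := by
  ext i; rfl

/-- Evaluating at `(shift g)⁻¹ * x` is pushing forward along translation by `shift g`. -/
theorem lamps_mul (g h : Wreath A) :
    lamps (g * h) = lamps g + (lamps h).mapDomain (· + (shift g).toAdd) := by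
  ext i
  obtain ⟨j, rfl⟩ : ∃ j, i = j + (shift g).toAdd := ⟨i - (shift g).toAdd, by simp⟩
  rw [Finsupp.add_apply, Finsupp.mapDomain_apply (add_left_injective _)]
  simp only [lamps_apply, Subgroup.coe_mul, RegularWreathProduct.mul_left, Pi.mul_apply, toAdd_mul]
  congr 3
  change (shift g)⁻¹ * Multiplicative.ofAdd (j + (shift g).toAdd) = Multiplicative.ofAdd j
  rw [ofAdd_add, ofAdd_toAdd, mul_comm, mul_inv_cancel_right]

theorem lamps_mul_of_shift_eq_one {g : Wreath A} (hg : shift g = 1) (h : Wreath A) :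
    lamps (g * h) = lamps g + lamps h := by
  simp only [lamps_mul, hg, toAdd_one, add_zero]
  exact congrArg _ Finsupp.mapDomain_id

theorem lamps_inv_of_shift_eq_one {g : Wreath A} (hg : shift g = 1) :
    lamps g⁻¹ = -lamps g := by
  rw [eq_neg_iff_add_eq_zero, ← lamps_mul_of_shift_eq_one (by simp [hg]), inv_mul_cancel, lamps_one]

theorem base_add (f f' : ℤ →₀ A) : base (f + f') = base f * base f' :=
  ext_lamps (by simp) (by rw [lamps_mul_of_shift_eq_one (shift_base f)]; simp)

@[simp] theorem base_zero : base (0 : ℤ →₀ A) = 1 := ext_lamps (by simp) (by simp)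

theorem lamps_conj {g h : Wreath A} (hh : shift h = 1) :
    lamps (g * h * g⁻¹) = (lamps h).mapDomain (· + (shift g).toAdd) := by
  have h1 : g * h * g⁻¹ * g = g * h := by group
  have h2 : lamps (g * h * g⁻¹ * g) = lamps (g * h) := by rw [h1]
  rw [lamps_mul_of_shift_eq_one (by simp [hh]), lamps_mul g h, add_comm] at h2
  exact add_left_cancel h2

/-! ### Reduction modulo `n` -/

/-- The function underlying an element of `A ≀ ℤ`, summed over the residue classes modulo `n`. -/
noncomputable def residues (n : ℕ) (g : Wreath A) : ZMod n →₀ A :=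
  (lamps g).mapDomain (Int.cast : ℤ → ZMod n)

/-- Reduction commutes with translation: together with the shift modulo `n`, residues multiply as in
`A ≀ ℤ/n`. -/
theorem residues_mul (n : ℕ) (g h : Wreath A) : residues n (g * h) =
    residues n g + (residues n h).mapDomain (· + ((shift g).toAdd : ZMod n)) := by
  simp only [residues, lamps_mul, Finsupp.mapDomain_add, ← Finsupp.mapDomain_comp]
  congr 2
  ext i
  simp

@[simp] theorem residues_one (n : ℕ) : residues n (1 : Wreath A) = 0 := by
  simp [residues]

theorem residues_mul_of_cast_eq_zero {n : ℕ} {g : Wreath A}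
    (hg : ((shift g).toAdd : ZMod n) = 0) (h : Wreath A) :
    residues n (g * h) = residues n g + residues n h := by
  simp only [residues_mul, hg, add_zero]
  exact congrArg _ Finsupp.mapDomain_id

variable (A) in
/-- The kernel of the reduction of `A ≀ ℤ` modulo `n`. -/
noncomputable def congruenceSubgroup (n : ℕ) : Subgroup (Wreath A) where
  carrier := {g | ((shift g).toAdd : ZMod n) = 0 ∧ residues n g = 0}
  one_mem' := by simp
  mul_mem' {g h} hg hh := by
    refine ⟨by simp [hg.1, hh.1], ?_⟩
    rw [residues_mul_of_cast_eq_zero hg.1, hg.2, hh.2, add_zero]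
  inv_mem' {g} hg := by
    refine ⟨by simp [hg.1], ?_⟩
    have := residues_mul_of_cast_eq_zero hg.1 g⁻¹
    rwa [mul_inv_cancel, residues_one, hg.2, zero_add, eq_comm] at this

theorem mem_congruenceSubgroup {n : ℕ} {g : Wreath A} : g ∈ congruenceSubgroup A n ↔
    ((shift g).toAdd : ZMod n) = 0 ∧ residues n g = 0 := Iff.rfl

instance congruenceSubgroup_normal (n : ℕ) : (congruenceSubgroup A n).Normal where
  conj_mem g hg h := by
    rw [mem_congruenceSubgroup] at hg ⊢
    refine ⟨by simp [hg.1], ?_⟩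
    have hh := residues_mul n h h⁻¹
    rw [mul_inv_cancel, residues_one] at hh
    rw [mul_assoc, residues_mul, residues_mul_of_cast_eq_zero hg.1, hg.2, zero_add, ← hh]

instance congruenceSubgroup_finiteIndex [Finite A] (n : ℕ) [NeZero n] :
    (congruenceSubgroup A n).FiniteIndex := by
  have : Finite (ZMod n →₀ A) := Finite.of_injective _ DFunLike.coe_injective
  refine Subgroup.finiteIndex_of_separating (α := ZMod n × (ZMod n →₀ A)) _
    (fun g ↦ (((shift g).toAdd : ZMod n), residues n g)) fun g h hgh ↦ ?_
  obtain ⟨h1, h2⟩ := Prod.mk.inj hgh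
  refine mem_congruenceSubgroup.2 ⟨by simp [h1], ?_⟩
  rw [residues_mul, ← h2, ← residues_mul, inv_mul_cancel, residues_one]

theorem exists_injOn_intCast (U : Set ℤ) (hU : U.Finite) :
    ∃ n : ℕ, n ≠ 0 ∧ Set.InjOn (Int.cast : ℤ → ZMod n) U := by
  obtain ⟨b, hb⟩ := (hU.image Int.natAbs).bddAbove
  -- Integers of absolute value at most `b` differ by at most `2b`, less than the modulus.
  refine ⟨2 * b + 1, by omega, fun x hx y hy hxy ↦ ?_⟩
  have h1 := hb (Set.mem_image_of_mem _ hx)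
  have h2 := hb (Set.mem_image_of_mem _ hy)
  rw [ZMod.intCast_eq_intCast_iff_dvd_sub] at hxy
  have := Int.eq_zero_of_abs_lt_dvd hxy (by rw [abs_lt]; push_cast; omega)
  omega

/-! ### Property (LR) -/

/-- A finitely generated subgroup of the base group is a virtual retract. -/
theorem isVirtualRetract_of_le_ker [Finite A] (H : Subgroup (Wreath A)) (hfg : H.FG)
    (hH : H ≤ shift.ker) : IsVirtualRetract H := by
  obtain ⟨S, hS⟩ := hfg
  let U : Set ℤ := ⋃ g ∈ S, ((lamps g).support : Set ℤ)
  have hU : U.Finite := S.finite_toSet.biUnion fun g _ ↦ Finset.finite_toSet _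
  have hHU : ∀ g ∈ H, lamps g ∈ Finsupp.supported A ℤ U := by
    intro g hg
    rw [← hS] at hg
    induction hg using Subgroup.closure_induction with
    | mem g hgS =>
      exact (Finsupp.mem_supported _ _).2 (Set.subset_biUnion_of_mem (u := fun g ↦
        ((lamps g).support : Set ℤ)) hgS)
    | one => simp
    | mul g h hg hh ihg ihh =>
      rw [hS] at hg hh
      rw [lamps_mul_of_shift_eq_one (hH hg)]
      exact Submodule.add_mem _ ihg ihh
    | inv g hg ih =>
      rw [hS] at hg
      rw [lamps_inv_of_shift_eq_one (hH hg)]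
      exact Submodule.neg_mem _ ih
  obtain ⟨n, hn, hinj⟩ := exists_injOn_intCast U hU
  have : NeZero n := ⟨hn⟩
  refine isVirtualRetract_of_complement (L := congruenceSubgroup A n)
    Subgroup.le_normalizer_of_normal ?_ (Subgroup.finiteIndex_of_le le_sup_left)
  rw [Subgroup.disjoint_def]
  intro g hgL hgH
  refine ext_lamps (hH hgH) ?_
  refine Finsupp.mapDomain_injOn U hinj (hHU g hgH) (by simp) ?_
  rw [lamps_one, Finsupp.mapDomain_zero]
  exact hgL.2

theorem finiteIndex_zpowers_of_ne_one {c : Multiplicative ℤ} (hc : c ≠ 1) :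
    (Subgroup.zpowers c).FiniteIndex := by
  have : NeZero c.toAdd.natAbs := ⟨by simpa using hc⟩
  refine Subgroup.finiteIndex_of_separating _ (fun x ↦ (x.toAdd : ZMod c.toAdd.natAbs))
    fun x y hxy ↦ ?_
  rw [ZMod.intCast_eq_intCast_iff_dvd_sub, Int.natAbs_dvd] at hxy
  obtain ⟨d, hd⟩ := hxy
  refine Subgroup.mem_zpowers_iff.2 ⟨d, ?_⟩
  apply Multiplicative.toAdd.injective
  simp only [toAdd_zpow, toAdd_mul, toAdd_inv, smul_eq_mul]
  linarith

/-- The action of `ℤ` on the base group of `A ≀ ℤ` by translation by the multiples of `m`. -/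
noncomputable def translate (R A : Type*) [Semiring R] [AddCommGroup A] [Module R A] (m : ℤ) :
    Multiplicative ℤ →* Module.End R (ℤ →₀ A) where
  toFun n := Finsupp.lmapDomain A R (· + n.toAdd * m)
  map_one' := by ext; simp
  map_mul' a b := by
    ext : 2
    simp [add_mul, add_comm, add_left_comm]

theorem translate_apply (R : Type*) [Semiring R] [Module R A] (m : ℤ) (n : Multiplicative ℤ)
    (f : ℤ →₀ A) : translate R A m n f = f.mapDomain (· + n.toAdd * m) := rfl

/-- A subgroup of `A ≀ ℤ`, for `A` a finite elementary abelian group, which is not contained in the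
base group is a virtual retract. -/
theorem isVirtualRetract_of_not_le_ker (p : ℕ) [Fact p.Prime] [Finite A] [Module (ZMod p) A]
    (H : Subgroup (Wreath A)) (hH : ¬ H ≤ shift.ker) : IsVirtualRetract H := by
  obtain ⟨c, hc⟩ := (Subgroup.isCyclic_iff_exists_zpowers_eq_top (H.map shift)).1 inferInstance
  set m := c.toAdd with hm
  have hc1 : c ≠ 1 := by
    rintro rfl
    rw [Subgroup.zpowers_one_eq_bot, eq_comm, Subgroup.map_eq_bot_iff] at hc
    exact hH hc
  have hm0 : m ≠ 0 := by simpa [hm] using hc1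
  have hshift : ∀ h ∈ H, ∃ n : Multiplicative ℤ, (shift h).toAdd = n.toAdd * m := by
    intro h hh
    have : shift h ∈ Subgroup.zpowers c := hc ▸ Subgroup.mem_map_of_mem _ hh
    obtain ⟨n, hn⟩ := Subgroup.mem_zpowers_iff.1 this
    exact ⟨Multiplicative.ofAdd n, by rw [← hn]; simp [hm]⟩
  have hshift' : ∀ n : Multiplicative ℤ, ∃ h ∈ H, (shift h).toAdd = n.toAdd * m := by
    intro n
    have : c ^ n.toAdd ∈ H.map shift := hc ▸ Subgroup.zpow_mem_zpowers c _
    obtain ⟨h, hh, he⟩ := this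
    exact ⟨h, hh, by rw [he]; simp [hm]⟩
  -- `N` is `H ∩ base`, written additively. Conjugation by elements of `H` realizes every
  -- translation by a multiple of `m`.
  let N : AddSubgroup (ℤ →₀ A) :=
    { carrier := {f | base f ∈ H}
      zero_mem' := by simp
      add_mem' := fun {f f'} hf hf' ↦ by
        rw [Set.mem_ofPred_eq, base_add]
        exact H.mul_mem hf hf'
      neg_mem' := fun {f} hf ↦ by
        have : base (-f) = (base f)⁻¹ := by
          rw [eq_inv_iff_mul_eq_one, ← base_add, neg_add_cancel, base_zero]
        rw [Set.mem_ofPred_eq, this]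
        exact H.inv_mem hf }
  have hN : ∀ n, ∀ f ∈ AddSubgroup.toZModSubmodule p N,
      translate (ZMod p) A m n f ∈ AddSubgroup.toZModSubmodule p N := by
    intro n f hf
    obtain ⟨h, hh, hs⟩ := hshift' n
    have hconj : base (translate (ZMod p) A m n f) = h * base f * h⁻¹ := by
      refine ext_lamps (by simp) ?_
      rw [lamps_conj (shift_base f), lamps_base, lamps_base, translate_apply, hs]
    change base _ ∈ H
    rw [hconj]
    exact H.mul_mem (H.mul_mem hh hf) (H.inv_mem hh)
  -- Division with remainder by `m` shows that the lamps at positions `0 ≤ i < |m|` generate the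
  -- base.
  obtain ⟨N', hinv, hd, hfin⟩ := exists_invariant_disjoint_finite_quotient
    (translate (ZMod p) A m)
    (Set.image2 (fun i a ↦ Finsupp.single i a) (Set.Ico (0 : ℤ) |m|) (Set.univ : Set A))
    ((Set.finite_Ico _ _).image2 _ Set.finite_univ) (by
      intro W hW hS
      rw [Submodule.eq_top_iff']
      intro f
      induction f using Finsupp.induction_linear with
      | zero => exact W.zero_mem
      | add f g hf hg => exact W.add_mem hf hg
      | single i a =>
        have hmem : Finsupp.single (i % m) a ∈ W :=
          hS ⟨i % m, ⟨Int.emod_nonneg i hm0, Int.emod_lt_abs i hm0⟩, a, trivial, rfl⟩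
        have := hW (Multiplicative.ofAdd (i / m)) _ hmem
        rw [translate_apply, Finsupp.mapDomain_single, toAdd_ofAdd] at this
        rwa [Int.emod_add_ediv_mul] at this) _ hN
  let L : Subgroup (Wreath A) :=
    { carrier := {g | shift g = 1 ∧ lamps g ∈ N'}
      one_mem' := by simp
      mul_mem' := fun {g h} hg hh ↦ by
        refine ⟨by simp [hg.1, hh.1], ?_⟩
        rw [lamps_mul_of_shift_eq_one hg.1]
        exact N'.add_mem hg.2 hh.2
      inv_mem' := fun {g} hg ↦ by
        refine ⟨by simp [hg.1], ?_⟩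
        rw [lamps_inv_of_shift_eq_one hg.1]
        exact N'.neg_mem hg.2 }
  refine isVirtualRetract_of_complement (L := L) ?_ ?_ ?_
  · rw [Subgroup.le_normalizer_iff]
    intro h hh l hl
    refine ⟨by simp [hl.1], ?_⟩
    obtain ⟨n, hn⟩ := hshift h hh
    rw [lamps_conj hl.1, hn, ← translate_apply (ZMod p)]
    exact hinv n _ hl.2
  · rw [Subgroup.disjoint_def]
    intro g hgL hgH
    refine ext_lamps hgL.1 ?_
    rw [lamps_one]
    refine Submodule.disjoint_def.1 hd _ ?_ hgL.2
    change base _ ∈ H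
    rwa [base_lamps hgL.1]
  -- `L ⊔ H` contains `N + N'`, of finite index in the base, and its image in `ℤ` contains `mℤ`.
  · have hker : ((L ⊔ H).subgroupOf (shift (A := A)).ker).FiniteIndex := by
      refine Subgroup.finiteIndex_of_separating _
        (fun b ↦ (AddSubgroup.toZModSubmodule p N ⊔ N').mkQ (lamps b.1)) fun g h hgh ↦ ?_
      rw [eq_comm, ← sub_eq_zero, ← map_sub, Submodule.mkQ_apply, Submodule.Quotient.mk_eq_zero,
        sub_eq_neg_add, ← lamps_inv_of_shift_eq_one g.2,
        ← lamps_mul_of_shift_eq_one (by rw [map_inv, g.2, inv_one]), Submodule.mem_sup] at hgh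
      obtain ⟨x, hx, y, hy, hxy⟩ := hgh
      have hgh : (g : Wreath A)⁻¹ * h = base y * base x := by
        rw [← base_add, add_comm, hxy, base_lamps]
        exact (shift (A := A)).ker.mul_mem ((shift (A := A)).ker.inv_mem g.2) h.2
      rw [Subgroup.mem_subgroupOf, Subgroup.coe_mul, Subgroup.coe_inv, hgh]
      exact Subgroup.mul_mem_sup ⟨by simp, by simpa using hy⟩ hx
    have hsup : ((L ⊔ H) ⊔ (shift (A := A)).ker).FiniteIndex := by
      have hz := finiteIndex_zpowers_of_ne_one hc1
      have : ((Subgroup.zpowers c).comap (shift (A := A))).FiniteIndex :=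
        ⟨by rw [Subgroup.index_comap_of_surjective _ shift_surjective]; exact hz.index_ne_zero⟩
      refine Subgroup.finiteIndex_of_le (H := (Subgroup.zpowers c).comap (shift (A := A))) ?_
      rw [hc, Subgroup.comap_map_eq]
      exact sup_le_sup_right le_sup_right _
    exact Subgroup.finiteIndex_of_finiteIndex_sup _ _ hker hsup

/-- The wreath product of a finite elementary abelian group with `ℤ` has property (LR). -/
theorem hasLR (p : ℕ) [Fact p.Prime] [Finite A] [Module (ZMod p) A] : HasLR (Wreath A) := by
  intro H hfg
  by_cases hH : H ≤ shift.ker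
  · exact isVirtualRetract_of_le_ker H hfg hH
  · exact isVirtualRetract_of_not_le_ker p H hH

/-! ### The automorphism `α` and its centralizer -/

theorem shift_alphaAut (g : KleinWreathZ) : shift (alphaAut g) = shift g := rfl

theorem lamps_alphaAut (g : KleinWreathZ) (i : ℤ) :
    lamps (alphaAut g) i = ((lamps g i).1 + (lamps g i).2, (lamps g i).2) := rfl

theorem alphaAut_eq_self_iff {g : KleinWreathZ} :
    alphaAut g = g ↔ ∀ i, (lamps g i).2 = 0 := by
  constructor
  · intro h i
    have := congrArg Prod.fst (lamps_alphaAut g i)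
    rw [h] at this
    simpa using this
  · intro h
    refine ext_lamps (shift_alphaAut g) (Finsupp.ext fun i ↦ ?_)
    rw [lamps_alphaAut, h i, add_zero]
    exact Prod.ext rfl (h i).symm

theorem orderOf_alphaAut : orderOf alphaAut = 2 := by
  refine orderOf_eq_prime ?_ ?_
  · ext1 g
    rw [pow_two]
    refine ext_lamps rfl (Finsupp.ext fun i ↦ ?_)
    rw [MulAut.mul_apply, lamps_alphaAut, lamps_alphaAut, add_assoc, CharTwo.add_self_eq_zero,
      add_zero]
    rfl
  · intro h
    have := alphaAut_eq_self_iff.1 (DFunLike.congr_fun h (base (Finsupp.single 0 (0, 1)))) 0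
    simp at this

theorem orderOf_alphaElt : orderOf alphaElt = 2 := by
  rw [alphaElt, orderOf_injective _ SemidirectProduct.inr_injective, Subgroup.orderOf_mk,
    orderOf_alphaAut]

theorem index_range_inl :
    (SemidirectProduct.inl : KleinWreathZ →* KleinWreathOvergroup).range.index = 2 := by
  rw [SemidirectProduct.range_inl_eq_ker_rightHom, Subgroup.index_ker,
    MonoidHom.range_eq_top.2 SemidirectProduct.rightHom_surjective, Subgroup.card_top,
    Nat.card_zpowers, orderOf_alphaAut]

/-- Powers of `α` commute with `α`, so only the left components impose a condition. -/
theorem mem_centralizer_alphaElt {x : KleinWreathOvergroup} :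
    x ∈ Subgroup.centralizer {alphaElt} ↔ alphaAut x.left = x.left := by
  rw [Subgroup.mem_centralizer_singleton_iff, SemidirectProduct.ext_iff]
  have hr : (x * alphaElt).right = (alphaElt * x).right := by
    obtain ⟨k, hk⟩ := x.right.2
    refine Subtype.ext ?_
    change (x.right : MulAut KleinWreathZ) * alphaAut = alphaAut * x.right
    rw [← hk]
    exact ((Commute.refl alphaAut).zpow_left k).eq
  have hl : (alphaElt * x).left = alphaAut x.left := by
    simp [alphaElt]
  have hl' : (x * alphaElt).left = x.left := by
    simp [alphaElt]
  rw [hl, hl']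
  tauto

/-- The generator of the acting group `ℤ` in `(ℤ₂)² ≀ ℤ`. -/
def gen : KleinWreathZ := translation (Multiplicative.ofAdd 1)

theorem shift_gen_zpow (i : ℤ) : (shift (gen ^ i)).toAdd = i := by
  simp [gen]

theorem lamps_gen_zpow (i : ℤ) : lamps (gen ^ i) = 0 := by
  rw [gen, ← map_zpow, lamps_translation]

theorem eq_base_mul_gen_zpow (g : KleinWreathZ) :
    g = base (lamps g) * gen ^ (shift g).toAdd := by
  refine ext_lamps ?_ ?_
  · apply Multiplicative.toAdd.injective
    rw [map_mul, shift_base, one_mul, shift_gen_zpow]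
  · rw [lamps_mul_of_shift_eq_one (shift_base _), lamps_base, lamps_gen_zpow, add_zero]

/-- The inclusion of the functions with values in the first factor of `ℤ₂ × ℤ₂`. -/
noncomputable def firstCoord : (ℤ →₀ ZMod 2) →+ (ℤ →₀ ZMod 2 × ZMod 2) :=
  Finsupp.mapRange.addMonoidHom (AddMonoidHom.inl _ _)

theorem base_single (i : ℤ) (a : ZMod 2 × ZMod 2) :
    base (Finsupp.single i a) = gen ^ i * base (Finsupp.single 0 a) * (gen ^ i)⁻¹ := by
  refine ext_lamps (by simp) ?_
  rw [lamps_conj (shift_base _), lamps_base, lamps_base, Finsupp.mapDomain_single, zero_add,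
    shift_gen_zpow]

/-- Conjugating the lamp at `0` by powers of `gen` gives the lamps at all positions. -/
theorem base_firstCoord_mem (f : ℤ →₀ ZMod 2) : base (firstCoord f) ∈
    Subgroup.closure {gen, base (Finsupp.single 0 ((1, 0) : ZMod 2 × ZMod 2))} := by
  induction f using Finsupp.induction_linear with
  | zero => rw [map_zero, base_zero]; exact Subgroup.one_mem _
  | add f g hf hg => rw [map_add, base_add]; exact Subgroup.mul_mem _ hf hg
  | single i a =>
    have hs : firstCoord (Finsupp.single i a) = Finsupp.single i (a, 0) := by
      simp [firstCoord]
    have hgen := Subgroup.zpow_mem _ (Subgroup.subset_closure (Set.mem_insert gen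
      {base (Finsupp.single 0 ((1, 0) : ZMod 2 × ZMod 2))})) i
    rw [hs, base_single i]
    refine Subgroup.mul_mem _ (Subgroup.mul_mem _ hgen ?_) (Subgroup.inv_mem _ hgen)
    obtain rfl | rfl : a = 0 ∨ a = 1 := by clear hs; revert a; decide
    · rw [Prod.mk_zero_zero, Finsupp.single_zero, base_zero]
      exact Subgroup.one_mem _
    · exact Subgroup.subset_closure (Set.mem_insert_of_mem _ rfl)

theorem mem_closure_of_alphaAut_eq_self {g : KleinWreathZ} (hg : alphaAut g = g) : g ∈
    Subgroup.closure {gen, base (Finsupp.single 0 ((1, 0) : ZMod 2 × ZMod 2))} := by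
  rw [eq_base_mul_gen_zpow g]
  refine Subgroup.mul_mem _ ?_
    (Subgroup.zpow_mem _ (Subgroup.subset_closure (Set.mem_insert _ _)) _)
  have hf : firstCoord ((lamps g).mapRange Prod.fst rfl) = lamps g := by
    refine Finsupp.ext fun i ↦ ?_
    exact Prod.ext rfl (alphaAut_eq_self_iff.1 hg i).symm
  rw [← hf]
  exact base_firstCoord_mem _

theorem centralizer_alphaElt_fg : (Subgroup.centralizer {alphaElt}).FG := by
  rw [Subgroup.fg_iff]
  refine ⟨insert alphaElt (SemidirectProduct.inl ''
    {gen, base (Finsupp.single 0 ((1, 0) : ZMod 2 × ZMod 2))}), le_antisymm ?_ ?_,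
    ((Set.toFinite _).image _).insert _⟩
  · rw [Subgroup.closure_le]
    rintro x (rfl | ⟨g, hg, rfl⟩)
    · exact Subgroup.mem_centralizer_singleton_iff.2 rfl
    · refine mem_centralizer_alphaElt.2 (alphaAut_eq_self_iff.2 fun i ↦ ?_)
      rw [SemidirectProduct.left_inl]
      obtain rfl | rfl := hg
      · rw [gen, lamps_translation]
        rfl
      · rw [lamps_base, Finsupp.single_apply]
        split_ifs <;> rfl
  · intro x hx
    rw [← SemidirectProduct.inl_left_mul_inr_right x]
    refine Subgroup.mul_mem _ ?_ ?_
    · have := Subgroup.mem_map_of_mem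
        (SemidirectProduct.inl : KleinWreathZ →* KleinWreathOvergroup)
        (mem_closure_of_alphaAut_eq_self (mem_centralizer_alphaElt.1 hx))
      rw [MonoidHom.map_closure] at this
      exact Subgroup.closure_mono (Set.subset_insert _ _) this
    · obtain ⟨k, hk⟩ := x.right.2
      have hr : x.right = ⟨alphaAut, Subgroup.mem_zpowers alphaAut⟩ ^ k := Subtype.ext hk.symm
      rw [hr, map_zpow]
      exact Subgroup.zpow_mem _ (Subgroup.subset_closure (Set.mem_insert _ _)) k

/-! ### The centralizer is not a virtual retract -/

open SemidirectProduct in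
/-- If the centralizer of `α` is a retract of `K`, then `α` fixes the intersection of `K` with the
base group. -/
theorem alphaAut_eq_self_of_retraction {K : Subgroup KleinWreathOvergroup}
    (hK : Subgroup.centralizer {alphaElt} ≤ K)
    (ρ : K →* Subgroup.centralizer {alphaElt})
    (hρ : ∀ h, ρ (Subgroup.inclusion hK h) = h) {m : KleinWreathZ} (hm : shift m = 1)
    (hmK : inl m ∈ K) : alphaAut m = m := by
  let c : Subgroup.centralizer {alphaElt} :=
    ⟨alphaElt, Subgroup.mem_centralizer_singleton_iff.2 rfl⟩
  let a : K := ⟨inl m, hmK⟩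
  have hconj : alphaElt * inl m * alphaElt⁻¹ = inl (alphaAut m) := by
    rw [alphaElt, ← map_inv, ← inl_aut]
    rfl
  -- The lamp values of `alphaAut m * m⁻¹` are `(y, 0)`, which the shear fixes.
  have hfix : alphaAut (alphaAut m * m⁻¹) = alphaAut m * m⁻¹ := by
    refine alphaAut_eq_self_iff.2 fun i ↦ ?_
    rw [lamps_mul_of_shift_eq_one (by rw [shift_alphaAut, hm]), lamps_inv_of_shift_eq_one hm,
      Finsupp.add_apply, Finsupp.neg_apply, lamps_alphaAut]
    exact add_neg_cancel _
  let d : Subgroup.centralizer {alphaElt} :=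
    ⟨inl (alphaAut m * m⁻¹), mem_centralizer_alphaElt.2 hfix⟩
  have hd : Subgroup.inclusion hK d
      = Subgroup.inclusion hK c * a * (Subgroup.inclusion hK c)⁻¹ * a⁻¹ := by
    refine Subtype.ext ?_
    change inl (alphaAut m * m⁻¹) = alphaElt * inl m * alphaElt⁻¹ * (inl m)⁻¹
    rw [hconj, map_mul, map_inv]
  have hcomm : c * ρ a = ρ a * c :=
    Subtype.ext (Subgroup.mem_centralizer_singleton_iff.1 (ρ a).2).symm
  -- `d` is the commutator of `c` and `a`; `ρ` fixes `d` and sends `a` into the centralizer of `c`.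
  have hd1 : d = 1 := by
    rw [← hρ d, hd, map_mul, map_mul, map_mul, map_inv, map_inv, hρ, hcomm]
    group
  have := congrArg Subtype.val hd1
  exact mul_inv_eq_one.1 (inl_injective (this.trans (map_one inl).symm))

theorem not_isVirtualRetract_centralizer_alphaElt :
    ¬ IsVirtualRetract (Subgroup.centralizer {alphaElt}) := by
  rintro ⟨K, hfin, hK, ρ, hρ⟩
  let b : ℤ → KleinWreathZ := fun i ↦ base (Finsupp.single i (0, 1))
  -- By pigeonhole two lamps `(0, 1)` at distinct positions lie in one coset of `K`. Their quotient
  -- lies in `K` but has second coordinate `1` at `j`, so `α` moves it.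
  obtain ⟨i, j, hij, hb⟩ := Finite.exists_ne_map_eq_of_infinite
    fun i : ℤ ↦ ((SemidirectProduct.inl (b i) : KleinWreathOvergroup) : KleinWreathOvergroup ⧸ K)
  have hmem := QuotientGroup.eq.1 hb
  rw [← map_inv, ← map_mul] at hmem
  have hi : shift (b i) = 1 := shift_base _
  have hj : shift (b j) = 1 := shift_base _
  have hfix := alphaAut_eq_self_iff.1 (alphaAut_eq_self_of_retraction hK ρ hρ
    (by rw [map_mul, map_inv, hi, hj, inv_one, one_mul]) hmem) j
  rw [lamps_mul_of_shift_eq_one (by rw [map_inv, hi, inv_one]),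
    lamps_inv_of_shift_eq_one hi] at hfix
  simp [b, hij] at hfix

end Lamplighter

open Lamplighter in
theorem mainTheorem8 :
    HasLR KleinWreathZ ∧
    orderOf alphaElt = 2 ∧
    (SemidirectProduct.inl : KleinWreathZ →* KleinWreathOvergroup).range.index = 2 ∧
    (Subgroup.centralizer {alphaElt}).FG ∧
    ¬ IsVirtualRetract (Subgroup.centralizer {alphaElt}) ∧
    ¬ HasLR KleinWreathOvergroup ∧
    ¬ (∀ (G₁ G₂ : Type) [Group G₁] [Group G₂],
        AreCommensurable G₁ G₂ → HasLR G₁ → HasLR G₂) := by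
  have hLR : HasLR KleinWreathZ := hasLR 2
  have hnot : ¬ HasLR KleinWreathOvergroup := fun h ↦
    not_isVirtualRetract_centralizer_alphaElt (h _ centralizer_alphaElt_fg)
  have hcomm : AreCommensurable KleinWreathZ KleinWreathOvergroup :=
    ⟨⊤, (SemidirectProduct.inl : KleinWreathZ →* KleinWreathOvergroup).range, inferInstance,
      ⟨by rw [index_range_inl]; exact two_ne_zero⟩,
      ⟨Subgroup.topEquiv.trans (MonoidHom.ofInjective SemidirectProduct.inl_injective)⟩⟩
  exact ⟨hLR, orderOf_alphaElt, index_range_inl, centralizer_alphaElt_fg,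
    not_isVirtualRetract_centralizer_alphaElt, hnot, fun h ↦ hnot (h _ _ hcomm hLR)⟩
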